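/- Let $n$ queues in discrete time each have their own dedicated server. Fix the law of a random vector $\hat s\in\mathbb{R}_+^n$ with $\hat s_i\le S_{\max}<\infty$ almost surely, mean $\boldsymbol\mu=\mathbb{E}[\hat s]$ with $\mu_i>0$ for all $i$, and covariance matrix $\Sigma_s$. For each $\epsilon\in(0,1)$ consider a system in which the potential service vectors $\hat s^{(\epsilon)}(k)$, $k\ge 0$, are i.i.d. with the law of $\hat s$, the arrival vectors $a^{(\epsilon)}(k)\in\mathbb{R}_+^n$, $k\ge0$, are i.i.d. with $a^{(\epsilon)}_i(k)\le A_{\max}<\infty$ almost surely ($A_{\max}$ not depending on $\epsilon$), mean $(1-\epsilon)\boldsymbol\mu$ and covariance matrix $\Sigma_a^{(\epsilon)}$, and the initial queue length vector $q^{(\epsilon)}(0)\in\mathbb{R}_+^n$, the arrival sequence and the service sequence are independent. The coordinates of one arrival vector, or of one service vector, may be arbitrarily correlated. The queue lengths satisfy $$q^{(\epsilon)}_i(k+1)=q^{(\epsilon)}_i(k)+a^{(\epsilon)}_i(k)-\hat s^{(\epsilon)}_i(k)+u^{(\epsilon)}_i(k),$$ where the unused service $u^{(\epsilon)}_i(k)=\hat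 s^{(\epsilon)}_i(k)-\min\{\hat s^{(\epsilon)}_i(k),\,q^{(\epsilon)}_i(k)+a^{(\epsilon)}_i(k)\}$ is the difference between the potential service and what is actually processed. Suppose that $\lim_{\epsilon\downarrow0}\Sigma_a^{(\epsilon)}=\Sigma_a$ component-wise, and let $\sigma_{a_i}^2=(\Sigma_a)_{i,i}$ and $\sigma_{s_i}^2=(\Sigma_s)_{i,i}$. Then for each $\epsilon\in(0,1)$ the vector $q^{(\epsilon)}(k)$ converges in distribution, as $k\to\infty$, to a steady-state vector $\overline q^{(\epsilon)}$ whose coordinates have finite mean, and $$\lim_{\epsilon\downarrow 0}\epsilon\,\mathbb{E}\Big[\sum_{i=1}^n\mu_i\overline q_i^{(\epsilon)}\Big]=\frac12\sum_{i=1}^n\big(\sigma_{a_i}^2+\sigma_{s_i}^2\big).$$ -/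

import Mathlib

open MeasureTheory ProbabilityTheory Filter Topology Set

/-- The mean vector of a law on `ℝⁿ`. -/
noncomputable def meanVec {n : ℕ} (ν : Measure (Fin n → ℝ)) (i : Fin n) : ℝ :=
  ∫ x, x i ∂ν

/-- The covariance matrix of a law on `ℝⁿ`. -/
noncomputable def covMat {n : ℕ} (ν : Measure (Fin n → ℝ)) : Matrix (Fin n) (Fin n) ℝ :=
  fun i j => cov[fun x => x i, fun x => x j; ν]

/-- The law `ν` on `ℝⁿ` is carried by the box `[0, K]ⁿ`. -/
def BoundedLaw {n : ℕ} (ν : Measure (Fin n → ℝ)) (K : ℝ) : Prop :=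
  ∀ᵐ x ∂ν, ∀ i, 0 ≤ x i ∧ x i ≤ K

/-- The unused service: the potential service `s i` minus what is actually processed from
queue `i`, when `q i` jobs are in line at the beginning of the slot and `a i` jobs arrive
in the slot before service takes place. -/
noncomputable def unusedService {n : ℕ} (q a s : Fin n → ℝ) (i : Fin n) : ℝ :=
  s i - min (s i) (q i + a i)

/-- A dedicated parallel-server system in discrete time on the probability space `(Ω, P)`:
`n` queues, each with its own server, with queue lengths `q k`, arrivals `a k` and potential
service `s k` in slot `k`. The arrival vectors are i.i.d. with law `α`, the potential service
vectors are i.i.d. with law `σ`, and the initial state, the arrivals and the services are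
independent. The coordinates of one vector `a k`, or of one vector `s k`, may be correlated. -/
structure IsDedicatedSystem {n : ℕ} {Ω : Type*} [MeasurableSpace Ω] (P : Measure Ω)
    (α σ : Measure (Fin n → ℝ)) (q a s : ℕ → Ω → Fin n → ℝ) : Prop where
  measurable_init : Measurable (q 0)
  measurable_arrival : ∀ k, Measurable (a k)
  measurable_service : ∀ k, Measurable (s k)
  law_arrival : ∀ k, P.map (a k) = α
  law_service : ∀ k, P.map (s k) = σ
  indep : iIndepFun (fun j : Unit ⊕ (ℕ ⊕ ℕ) => Sum.elim (fun _ => q 0) (Sum.elim a s) j) P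
  init_nonneg : ∀ᵐ ω ∂P, ∀ i, 0 ≤ q 0 ω i
  dynamics : ∀ k ω i,
    q (k + 1) ω i = q k ω i + a k ω i - s k ω i + unusedService (q k ω) (a k ω) (s k ω) i

/-! Each queue is a Lindley recursion `q ↦ (q + x) ⊔ 0` with i.i.d. bounded increments `x = a - s`
of mean `-δ`, where `δ = ε μ_i`. Started at `0`, its state at time `k` has the law of the same
recursion run on reversed increments, and that version is nondecreasing in `k` (`loynes_monotone`).
So its moments are monotone, and it converges almost surely, in all coordinates at once; the law of
the limit is the steady state. Any other initial state is forgotten, because the walk drifts to `-∞`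
(`eventually_lindley_eq`).

The mean comes from the drift of the square. With `u` the unused service, `u * (q + x)⁺ = 0`, so the
drift of `q²` is `-2δ E q + E x² - E u²`. In the limit the increments of the first two moments
vanish, whence `E u = δ`, `E u² ≤ S δ` and `2δ E q = E x² + O(δ)` (`exists_limit_of_drift`). As `E
x²` is the sum of the two variances plus `δ²`, halving and letting `ε → 0` gives the claim.
Correlation between coordinates never enters, since the sum is linear in the queues. -/

/-! ### Lindley recursion and its time reversal -/

section Lindley

variable {E : Type*} [AddCommGroup E] [Lattice E]

/-- The Lindley recursion with increments `x` started at `q`. -/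
def lindley (x : ℕ → E) (q : E) : ℕ → E
  | 0 => q
  | k + 1 => (lindley x q k + x k) ⊔ 0

@[simp] lemma lindley_zero (x : ℕ → E) (q : E) : lindley x q 0 = q := rfl

lemma lindley_succ (x : ℕ → E) (q : E) (k : ℕ) :
    lindley x q (k + 1) = (lindley x q k + x k) ⊔ 0 := rfl

lemma lindley_congr {x y : ℕ → E} (q : E) {k : ℕ} (h : ∀ i < k, x i = y i) :
    lindley x q k = lindley y q k := by
  induction k with
  | zero => rfl
  | succ k ih =>
    rw [lindley_succ, lindley_succ, ih fun i hi => h i (hi.trans k.lt_succ_self),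
      h k k.lt_succ_self]

lemma lindley_nonneg (x : ℕ → E) {q : E} (hq : 0 ≤ q) (k : ℕ) : 0 ≤ lindley x q k := by
  cases k with
  | zero => exact hq
  | succ k => exact le_sup_right

lemma lindley_succ_left (x : ℕ → E) (q : E) (k : ℕ) :
    lindley x q (k + 1) = lindley (fun i => x (i + 1)) ((q + x 0) ⊔ 0) k := by
  induction k with
  | zero => rfl
  | succ k ih => rw [lindley_succ, ih, lindley_succ]

lemma lindley_mono [IsOrderedAddMonoid E] (x : ℕ → E) (k : ℕ) :
    Monotone fun q => lindley x q k := by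
  intro q r h
  induction k with
  | zero => exact h
  | succ k ih => exact sup_le_sup_right (add_le_add_left ih _) _

/-- The initial state enters only through the untruncated walk, so it is forgotten wherever that
walk is nonpositive. -/
lemma lindley_eq_sup [IsOrderedAddMonoid E] (x : ℕ → E) {q : E} (hq : 0 ≤ q) (k : ℕ) :
    lindley x q k = lindley x 0 k ⊔ (q + ∑ i ∈ Finset.range k, x i) := by
  induction k with
  | zero => simp [hq]
  | succ k ih =>
    rw [lindley_succ, ih, lindley_succ, Finset.sum_range_succ, sup_add, sup_right_comm,
      add_assoc]

/-- The permutation of `ℕ` that reverses the order of the first `k` numbers. -/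
def reversal (k : ℕ) : Equiv.Perm ℕ :=
  Function.Involutive.toPerm (fun i => if i < k then k - 1 - i else i) fun i => by
    dsimp only
    split_ifs <;> omega

lemma reversal_of_lt {k i : ℕ} (h : i < k) : reversal k i = k - 1 - i := if_pos h

/-- The Lindley recursion started at `0` with the first `k` increments taken in reversed order. -/
def loynes (x : ℕ → E) (k : ℕ) : E := lindley (fun i => x (reversal k i)) 0 k

/-- Reversal of `k + 1` increments puts `x k` first. The remaining steps are those of `loynes x k`,
but started from `x k ⊔ 0 ≥ 0` instead of `0`. -/
lemma loynes_monotone [IsOrderedAddMonoid E] (x : ℕ → E) : Monotone (loynes x) := by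
  refine monotone_nat_of_le_succ fun k => ?_
  have h : loynes x (k + 1) = lindley (fun i => x (reversal k i)) ((0 + x k) ⊔ 0) k := by
    rw [loynes, lindley_succ_left, reversal_of_lt k.succ_pos]
    refine lindley_congr _ fun i hi => ?_
    rw [reversal_of_lt hi, reversal_of_lt (by omega)]
    congr 1
    omega
  rw [h]
  exact lindley_mono _ k le_sup_right

end Lindley

lemma lindley_apply {ι : Type*} (x : ℕ → ι → ℝ) (q : ι → ℝ) (k : ℕ) (i : ι) :
    lindley x q k i = lindley (fun j => x j i) (q i) k := by
  induction k with
  | zero => rfl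
  | succ k ih => simp only [lindley_succ, Pi.sup_apply, Pi.add_apply, ih, Pi.zero_apply]

lemma loynes_apply {ι : Type*} (x : ℕ → ι → ℝ) (k : ℕ) (i : ι) :
    loynes x k i = loynes (fun j => x j i) k :=
  lindley_apply _ _ _ _

@[fun_prop]
lemma measurable_lindley_real (k : ℕ) : Measurable fun x : ℕ → ℝ => lindley x 0 k := by
  induction k with
  | zero => exact measurable_const
  | succ k ih => exact (ih.add (measurable_pi_apply k)).sup_const 0

@[fun_prop]
lemma measurable_lindley {ι : Type*} (k : ℕ) :
    Measurable fun x : ℕ → ι → ℝ => lindley x 0 k := by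
  refine measurable_pi_iff.2 fun i => ?_
  simp only [lindley_apply]
  exact (measurable_lindley_real k).comp (by fun_prop)

/-! ### Independence and exchangeability of the increments -/

section Law

variable {Ω E : Type*} [MeasurableSpace Ω] [MeasurableSpace E] {P : Measure Ω} {X : ℕ → Ω → E}

/-- The law of an i.i.d. sequence is invariant under permutations. -/
lemma map_comp_perm_eq (hX : ∀ k, Measurable (X k)) (hind : iIndepFun X P)
    (hlaw : ∀ k, P.map (X k) = P.map (X 0)) (e : Equiv.Perm ℕ) :
    P.map (fun ω i => X (e i) ω) = P.map (fun ω i => X i ω) := by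
  rw [(hind.precomp e.injective).map_fun_eq_infinitePi_map fun i => hX (e i),
    hind.map_fun_eq_infinitePi_map hX]
  simp only [hlaw]

/-- If the random variables `X i j` indexed by pairs `(i, j)` are independent, so are the
families `(X i j)_j`. -/
lemma iIndepFun_curry {ι κ : Type*} [IsProbabilityMeasure P] {X : ι → κ → Ω → E}
    (hX : ∀ i j, Measurable (X i j)) (h : iIndepFun (fun (p : ι × κ) ω => X p.1 p.2 ω) P) :
    iIndepFun (fun i ω j => X i j ω) P := by
  have hp : ∀ i j, IsProbabilityMeasure (P.map (X i j)) :=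
    fun i j => Measure.isProbabilityMeasure_map (hX i j).aemeasurable
  rw [iIndepFun_iff_map_fun_eq_infinitePi_map fun i => by fun_prop]
  have hi : ∀ i, P.map (fun ω j => X i j ω) = Measure.infinitePi fun j => P.map (X i j) :=
    fun i => (h.precomp (g := fun j => (i, j)) (Prod.mk_right_injective i)).map_fun_eq_infinitePi_map
      (hX i)
  have hjoint : P.map (fun ω (p : ι × κ) => X p.1 p.2 ω) =
      Measure.infinitePi fun p : ι × κ => P.map (X p.1 p.2) :=
    h.map_fun_eq_infinitePi_map fun p => hX p.1 p.2
  simp only [hi]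
  rw [← Measure.infinitePi_map_curry fun i j => P.map (X i j), ← hjoint,
    Measure.map_map (by fun_prop) (by fun_prop)]
  rfl

lemma iIndepFun_prodMk_of_sum {a s : ℕ → Ω → E} (ha : ∀ k, Measurable (a k))
    (hs : ∀ k, Measurable (s k)) (h : iIndepFun (fun j => Sum.elim a s j) P) :
    iIndepFun (fun k ω => (a k ω, s k ω)) P := by
  have := h.isProbabilityMeasure
  let g : ℕ × Bool → ℕ ⊕ ℕ := fun p => bif p.2 then .inl p.1 else .inr p.1
  have hg : g.Injective := by
    rintro ⟨i, _ | _⟩ ⟨j, _ | _⟩ hij <;> simp_all [g]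
  have hc := iIndepFun_curry (X := fun k b => Sum.elim a s (g (k, b)))
    (by rintro k (_ | _); exacts [hs k, ha k]) (h.precomp hg)
  exact hc.comp (fun _ f => (f true, f false)) fun _ => by fun_prop

lemma indepFun_lindley {X : ℕ → Ω → ℝ} (hX : ∀ k, Measurable (X k)) (hind : iIndepFun X P) (k : ℕ) :
    IndepFun (fun ω => lindley (fun i => X i ω) 0 k) (X k) P := by
  have h := hind.indepFun_finset (Finset.range k) {k} (by simp) hX
  -- Padding by `0` is harmless: the state at time `k` reads only the increments before `k`.
  let ext : (Finset.range k → ℝ) → ℕ → ℝ := fun x i =>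
    if hi : i ∈ Finset.range k then x ⟨i, hi⟩ else 0
  have hext : Measurable ext := measurable_pi_iff.2 fun i => by
    by_cases hi : i ∈ Finset.range k
    · simpa only [ext, hi, dite_true] using measurable_pi_apply _
    · simpa only [ext, hi, dite_false] using measurable_const
  have h' := h.comp ((measurable_lindley_real k).comp hext)
    (measurable_pi_apply (⟨k, Finset.mem_singleton_self k⟩ : ({k} : Finset ℕ)))
  refine h'.congr (.of_forall fun ω => ?_) (.of_forall fun ω => rfl)
  exact lindley_congr 0 fun i hi => dif_pos (Finset.mem_range.2 hi)

/-- The laws agree for each fixed `k` only; the two processes differ in law, one being monotone in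
`k`. -/
lemma map_loynes_eq {X : ℕ → Ω → E} [AddCommGroup E] [Lattice E]
    (hX : ∀ k, Measurable (X k)) (hind : iIndepFun X P)
    (hlaw : ∀ k, P.map (X k) = P.map (X 0)) {k : ℕ}
    (hm : Measurable fun x : ℕ → E => lindley x 0 k) :
    P.map (fun ω => loynes (fun i => X i ω) k) = P.map (fun ω => lindley (fun i => X i ω) 0 k) := by
  have h := congr_arg (Measure.map fun x : ℕ → E => lindley x 0 k)
    (map_comp_perm_eq hX hind hlaw (reversal k))
  rwa [Measure.map_map hm (by fun_prop), Measure.map_map hm (by fun_prop)] at h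

end Law

/-! ### Drift estimates for powers of one step -/

lemma lindley_le_mul {x : ℕ → ℝ} {C : ℝ} (hx : ∀ k, |x k| ≤ C) (k : ℕ) :
    lindley x 0 k ≤ k * C := by
  have hC : 0 ≤ C := (abs_nonneg _).trans (hx 0)
  induction k with
  | zero => simp
  | succ k ih =>
    rw [lindley_succ]
    refine sup_le ?_ (by positivity)
    push_cast
    linarith [le_abs_self (x k), hx k]

/-- The correction `u = (q + x) ⊔ 0 - q - x` vanishes unless the new state is `0`, so `(q + x)²`
splits without a cross term. -/
lemma max_add_zero_pow_two (q x : ℝ) :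
    ((q + x) ⊔ 0) ^ 2 = q ^ 2 + 2 * (q * x) + x ^ 2 - ((q + x) ⊔ 0 - q - x) ^ 2 := by
  rcases le_total (q + x) 0 with h | h
  · rw [sup_eq_right.2 h]; ring
  · rw [sup_eq_left.2 h]; ring

lemma max_add_zero_pow_three_le {q x C : ℝ} (hq : 0 ≤ q) (hx : |x| ≤ C) :
    ((q + x) ⊔ 0) ^ 3 ≤ q ^ 3 + 3 * (q ^ 2 * x) + 3 * (q * x ^ 2) + C ^ 3 := by
  have hC : |x| ^ 3 ≤ C ^ 3 := pow_le_pow_left₀ (abs_nonneg x) hx 3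
  rcases le_total (q + x) 0 with h | h
  · rw [sup_eq_right.2 h]
    rw [abs_of_nonpos (by linarith)] at hC
    -- This says that `q³ + 3q²x + 3qx² = (-x)³ - (-x - q)³` is nonnegative.
    have h1 : (-x - q) ^ 3 ≤ (-x) ^ 3 := pow_le_pow_left₀ (by linarith) (by linarith) 3
    have h2 : 0 ≤ (-x) ^ 3 := pow_nonneg (by linarith) 3
    nlinarith
  · rw [sup_eq_left.2 h]
    have h1 : x ^ 3 ≤ |x| ^ 3 := by
      rw [← abs_pow]; exact le_abs_self _
    nlinarith

/-- Limit of the first moments of a stochastically increasing nonnegative chain, from the drifts of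
its first three moments. -/
lemma exists_limit_of_drift {e₁ e₂ e₃ w w₂ : ℕ → ℝ} {δ v S D : ℝ} (hδ : 0 < δ)
    (m₁ : Monotone e₁) (m₂ : Monotone e₂) (m₃ : Monotone e₃) (hv : 0 ≤ v)
    (h₁ : ∀ k, e₁ (k + 1) = e₁ k - δ + w k)
    (h₂ : ∀ k, e₂ (k + 1) = e₂ k - 2 * δ * e₁ k + v - w₂ k)
    (h₃ : ∀ k, e₃ (k + 1) ≤ e₃ k - 3 * δ * e₂ k + 3 * v * e₁ k + D)
    (hw₀ : ∀ k, 0 ≤ w₂ k) (hw : ∀ k, w₂ k ≤ S * w k) :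
    ∃ m, Tendsto e₁ atTop (𝓝 m) ∧ v - S * δ ≤ 2 * δ * m ∧ 2 * δ * m ≤ v := by
  -- Monotonicity of each moment bounds the one below it. The third moment serves only to bound the
  -- second, so that the increments of `e₂` tend to `0`.
  have b₁ : ∀ k, e₁ k ≤ v / (2 * δ) := fun k => by
    rw [le_div_iff₀ (by positivity)]
    linarith [m₂ k.le_succ, h₂ k, hw₀ k]
  have b₂ : ∀ k, e₂ k ≤ (3 * v * (v / (2 * δ)) + D) / (3 * δ) := fun k => by
    rw [le_div_iff₀ (by positivity)]
    linarith [m₃ k.le_succ, h₃ k, mul_le_mul_of_nonneg_left (b₁ k) (mul_nonneg zero_le_three hv)]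
  have t₁ := tendsto_atTop_ciSup m₁ ⟨_, forall_mem_range.2 b₁⟩
  have t₂ := tendsto_atTop_ciSup m₂ ⟨_, forall_mem_range.2 b₂⟩
  refine ⟨_, t₁, ?_, ?_⟩
  · have d₁ := ((tendsto_add_atTop_iff_nat 1).2 t₁).sub t₁
    have d₂ := ((tendsto_add_atTop_iff_nat 1).2 t₂).sub t₂
    -- The sequence is `v - S * w k - (e₂ (k + 1) - e₂ k)`, which is at most `2 * δ * e₁ k` because
    -- `w₂ k ≤ S * w k`.
    have hl := ((d₁.add_const δ).const_mul S).const_sub v |>.sub d₂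
    simp only [sub_self, zero_add, sub_zero] at hl
    refine le_of_tendsto_of_tendsto' hl (t₁.const_mul (2 * δ)) fun k => ?_
    have : e₁ (k + 1) - e₁ k + δ = w k := by linarith [h₁ k]
    rw [this]
    linarith [h₂ k, hw k]
  · exact le_of_tendsto' (t₁.const_mul (2 * δ)) fun k => by
      linarith [m₂ k.le_succ, h₂ k, hw₀ k]

/-! ### Moments, almost sure limit and loss of memory -/

section Moments

variable {Ω : Type*} [MeasurableSpace Ω] {P : Measure Ω}
  {X : ℕ → Ω → ℝ} {C : ℝ}

lemma measurable_lindley_comp (hX : ∀ k, Measurable (X k)) (k : ℕ) :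
    Measurable fun ω => lindley (fun i => X i ω) 0 k :=
  (measurable_lindley_real k).comp (measurable_pi_iff.2 hX)

lemma measurable_loynes_comp (hX : ∀ k, Measurable (X k)) (k : ℕ) :
    Measurable fun ω => loynes (fun i => X i ω) k :=
  (measurable_lindley_real k).comp (measurable_pi_iff.2 fun _ => hX _)

lemma integrable_lindley_pow_mul_pow [IsProbabilityMeasure P] (hX : ∀ k, Measurable (X k))
    (hC : ∀ᵐ ω ∂P, ∀ k, |X k ω| ≤ C) (k p r : ℕ) :
    Integrable (fun ω => lindley (fun i => X i ω) 0 k ^ p * X k ω ^ r) P := by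
  refine Integrable.of_bound (C := (k * C) ^ p * C ^ r)
    (((measurable_lindley_comp hX k).pow_const p).mul
      ((hX k).pow_const r)).aestronglyMeasurable ?_
  filter_upwards [hC] with ω hω
  have h0 : 0 ≤ lindley (fun i => X i ω) 0 k := lindley_nonneg _ le_rfl k
  have h1 := lindley_le_mul hω k
  rw [norm_mul, norm_pow, norm_pow, Real.norm_eq_abs, Real.norm_eq_abs, abs_of_nonneg h0]
  exact mul_le_mul (pow_le_pow_left₀ h0 h1 p) (pow_le_pow_left₀ (abs_nonneg _) (hω k) r)
    (by positivity) (pow_nonneg (h0.trans h1) p)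

lemma integral_lindley_pow_mul_pow (hX : ∀ k, Measurable (X k)) (hind : iIndepFun X P)
    (hlaw : ∀ k, P.map (X k) = P.map (X 0)) (k p r : ℕ) :
    ∫ ω, lindley (fun i => X i ω) 0 k ^ p * X k ω ^ r ∂P =
      (∫ ω, lindley (fun i => X i ω) 0 k ^ p ∂P) * ∫ ω, X 0 ω ^ r ∂P := by
  have h := (indepFun_lindley hX hind k).comp (measurable_id.pow_const p)
    (measurable_id.pow_const r)
  have h' := h.integral_fun_mul_eq_mul_integral
    ((measurable_lindley_comp hX k).pow_const p).aestronglyMeasurable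
    ((hX k).pow_const r).aestronglyMeasurable
  have hr : ∫ ω, X k ω ^ r ∂P = ∫ ω, X 0 ω ^ r ∂P := by
    have hid : IdentDistrib (X k) (X 0) P P :=
      ⟨(hX k).aemeasurable, (hX 0).aemeasurable, hlaw k⟩
    exact (hid.comp (measurable_id.pow_const r)).integral_eq
  rw [← hr]
  exact h'

lemma identDistrib_loynes (hX : ∀ k, Measurable (X k)) (hind : iIndepFun X P)
    (hlaw : ∀ k, P.map (X k) = P.map (X 0)) (k : ℕ) :
    IdentDistrib (fun ω => loynes (fun i => X i ω) k) (fun ω => lindley (fun i => X i ω) 0 k) P P :=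
  ⟨(measurable_loynes_comp hX k).aemeasurable, (measurable_lindley_comp hX k).aemeasurable,
    map_loynes_eq hX hind hlaw (measurable_lindley_real k)⟩

lemma integrable_lindley_pow [IsProbabilityMeasure P] (hX : ∀ k, Measurable (X k))
    (hC : ∀ᵐ ω ∂P, ∀ k, |X k ω| ≤ C) (k p : ℕ) :
    Integrable (fun ω => lindley (fun i => X i ω) 0 k ^ p) P := by
  simpa using integrable_lindley_pow_mul_pow hX hC k p 0

lemma monotone_integral_lindley_pow [IsProbabilityMeasure P]
    (hX : ∀ k, Measurable (X k)) (hind : iIndepFun X P)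
    (hlaw : ∀ k, P.map (X k) = P.map (X 0)) (hC : ∀ᵐ ω ∂P, ∀ k, |X k ω| ≤ C) (p : ℕ) :
    Monotone fun k => ∫ ω, lindley (fun i => X i ω) 0 k ^ p ∂P := by
  intro k l hkl
  have h : ∀ k, IdentDistrib (fun ω => loynes (fun i => X i ω) k ^ p)
      (fun ω => lindley (fun i => X i ω) 0 k ^ p) P P :=
    fun k => (identDistrib_loynes hX hind hlaw k).comp (measurable_id.pow_const p)
  dsimp only
  rw [← (h k).integral_eq, ← (h l).integral_eq]
  refine integral_mono ((h k).integrable_iff.2 (integrable_lindley_pow hX hC k p))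
    ((h l).integrable_iff.2 (integrable_lindley_pow hX hC l p)) fun ω => ?_
  exact pow_le_pow_left₀ (lindley_nonneg _ le_rfl k) (loynes_monotone _ hkl) p

/-- The mean of the Lindley recursion converges, to a limit given by the variance of the increments
up to an error of the order of the drift. -/
lemma exists_tendsto_integral_lindley [IsProbabilityMeasure P] {δ S : ℝ}
    (hX : ∀ k, Measurable (X k)) (hind : iIndepFun X P)
    (hlaw : ∀ k, P.map (X k) = P.map (X 0)) (hC : ∀ᵐ ω ∂P, ∀ k, |X k ω| ≤ C)
    (hS : ∀ᵐ ω ∂P, ∀ k, -S ≤ X k ω) (hδ : 0 < δ) (hmean : ∫ ω, X 0 ω ∂P = -δ) :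
    ∃ m, Tendsto (fun k => ∫ ω, lindley (fun i => X i ω) 0 k ∂P) atTop (𝓝 m) ∧
      ∫ ω, X 0 ω ^ 2 ∂P - S * δ ≤ 2 * δ * m ∧ 2 * δ * m ≤ ∫ ω, X 0 ω ^ 2 ∂P := by
  let Q : ℕ → Ω → ℝ := fun k ω => lindley (fun i => X i ω) 0 k
  -- `U k` is the unused service in slot `k`.
  let U : ℕ → Ω → ℝ := fun k ω => Q (k + 1) ω - Q k ω - X k ω
  have hi : ∀ k p r, Integrable (fun ω => Q k ω ^ p * X k ω ^ r) P :=
    integrable_lindley_pow_mul_pow hX hC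
  have he : ∀ k p r, ∫ ω, Q k ω ^ p * X k ω ^ r ∂P = (∫ ω, Q k ω ^ p ∂P) * ∫ ω, X 0 ω ^ r ∂P :=
    integral_lindley_pow_mul_pow hX hind hlaw
  have hm := monotone_integral_lindley_pow hX hind hlaw hC
  have iQ : ∀ k p, Integrable (fun ω => Q k ω ^ p) P := integrable_lindley_pow hX hC
  have iQ1 : ∀ k, Integrable (Q k) P := fun k => by simpa using iQ k 1
  have iX : ∀ k r, Integrable (fun ω => X k ω ^ r) P := fun k r => by simpa using hi k 0 r
  have iX1 : ∀ k, Integrable (X k) P := fun k => by simpa using iX k 1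
  have eX : ∀ k r, ∫ ω, X k ω ^ r ∂P = ∫ ω, X 0 ω ^ r ∂P := fun k r => by
    simpa using he k 0 r
  have eX1 : ∀ k, ∫ ω, X k ω ∂P = -δ := fun k => by simpa [hmean] using eX k 1
  have iU : ∀ k, Integrable (U k) P := fun k => ((iQ1 _).sub (iQ1 _)).sub (iX1 k)
  have iQX : ∀ k, Integrable (fun ω => Q k ω * X k ω) P := fun k => by simpa using hi k 1 1
  have hU2 : ∀ k ω, U k ω ^ 2 = Q k ω ^ 2 + 2 * (Q k ω * X k ω) + X k ω ^ 2 - Q (k + 1) ω ^ 2 :=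
    fun k ω => by
      have := max_add_zero_pow_two (Q k ω) (X k ω)
      change Q (k + 1) ω ^ 2 = _ - U k ω ^ 2 at this
      linarith
  have iA : ∀ k, Integrable (fun ω => Q k ω ^ 2 + 2 * (Q k ω * X k ω)) P :=
    fun k => (iQ k 2).add ((iQX k).const_mul 2)
  have iB : ∀ k, Integrable (fun ω => Q k ω ^ 2 + 2 * (Q k ω * X k ω) + X k ω ^ 2) P :=
    fun k => (iA k).add (iX k 2)
  have iU2 : ∀ k, Integrable (fun ω => U k ω ^ 2) P := fun k => by
    simp only [hU2]
    exact (iB k).sub (iQ (k + 1) 2)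
  refine exists_limit_of_drift (e₂ := fun k => ∫ ω, Q k ω ^ 2 ∂P)
    (e₃ := fun k => ∫ ω, Q k ω ^ 3 ∂P) (w := fun k => ∫ ω, U k ω ∂P)
    (w₂ := fun k => ∫ ω, U k ω ^ 2 ∂P) (D := C ^ 3) hδ (by simpa using hm 1) (hm 2) (hm 3)
    (integral_nonneg fun ω => sq_nonneg _) (fun k => ?_) (fun k => ?_) (fun k => ?_)
    (fun k => integral_nonneg fun ω => sq_nonneg _) (fun k => ?_)
  · have : ∫ ω, U k ω ∂P = ∫ ω, Q (k + 1) ω ∂P - ∫ ω, Q k ω ∂P - ∫ ω, X k ω ∂P := by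
      rw [integral_sub (f := fun ω => Q (k + 1) ω - Q k ω) ((iQ1 _).sub (iQ1 _)) (iX1 k),
        integral_sub (iQ1 _) (iQ1 _)]
    rw [this, eX1]
    ring
  · have h11 := he k 1 1
    simp only [pow_one, hmean] at h11
    simp only [hU2]
    rw [integral_sub (iB k) (iQ (k + 1) 2), integral_add (iA k) (iX k 2),
      integral_add (iQ k 2) ((iQX k).const_mul 2), integral_const_mul, h11, eX k 2]
    ring
  · have h21 := he k 2 1
    have h12 := he k 1 2
    simp only [pow_one, hmean] at h21 h12
    have j21 : Integrable (fun ω => Q k ω ^ 2 * X k ω) P := by simpa using hi k 2 1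
    have j12 : Integrable (fun ω => Q k ω * X k ω ^ 2) P := by simpa using hi k 1 2
    have i1 : Integrable (fun ω => Q k ω ^ 3 + 3 * (Q k ω ^ 2 * X k ω)) P :=
      (iQ k 3).add (j21.const_mul 3)
    have i2 : Integrable (fun ω => Q k ω ^ 3 + 3 * (Q k ω ^ 2 * X k ω) +
      3 * (Q k ω * X k ω ^ 2)) P := i1.add (j12.const_mul 3)
    have hle : ∫ ω, Q (k + 1) ω ^ 3 ∂P ≤ ∫ ω, Q k ω ^ 3 + 3 * (Q k ω ^ 2 * X k ω) +
        3 * (Q k ω * X k ω ^ 2) + C ^ 3 ∂P := by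
      refine integral_mono_ae (iQ (k + 1) 3) (i2.add (integrable_const _)) ?_
      filter_upwards [hC] with ω hω
      exact max_add_zero_pow_three_le (lindley_nonneg _ le_rfl k) (hω k)
    rw [integral_add i2 (integrable_const _), integral_add i1 (j12.const_mul 3),
      integral_add (iQ k 3) (j21.const_mul 3), integral_const_mul, integral_const_mul, h21, h12,
      integral_const, probReal_univ, one_smul] at hle
    linarith
  · rw [← integral_const_mul]
    refine integral_mono_ae (iU2 k) ((iU k).const_mul S) ?_
    filter_upwards [hS] with ω hω
    have h0 : 0 ≤ Q k ω := lindley_nonneg _ le_rfl k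
    have hU : U k ω = (Q k ω + X k ω) ⊔ 0 - Q k ω - X k ω := rfl
    rw [hU]
    -- If the queue empties, `0 ≤ U = -(Q + X) ≤ -X ≤ S`, so `U² ≤ S * U`; otherwise `U = 0`.
    rcases le_total (Q k ω + X k ω) 0 with h | h
    · rw [sup_eq_right.2 h]
      nlinarith [hω k]
    · rw [sup_eq_left.2 h]
      simp

lemma integral_loynes_limit [IsProbabilityMeasure P] {δ S : ℝ}
    (hX : ∀ k, Measurable (X k)) (hind : iIndepFun X P)
    (hlaw : ∀ k, P.map (X k) = P.map (X 0)) (hC : ∀ᵐ ω ∂P, ∀ k, |X k ω| ≤ C)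
    (hS : ∀ᵐ ω ∂P, ∀ k, -S ≤ X k ω) (hδ : 0 < δ) (hmean : ∫ ω, X 0 ω ∂P = -δ) :
    ∃ M : Ω → ℝ, Integrable M P ∧
      (∀ᵐ ω ∂P, Tendsto (loynes fun i => X i ω) atTop (𝓝 (M ω))) ∧
      ∫ ω, X 0 ω ^ 2 ∂P - S * δ ≤ 2 * δ * ∫ ω, M ω ∂P ∧
      2 * δ * ∫ ω, M ω ∂P ≤ ∫ ω, X 0 ω ^ 2 ∂P := by
  obtain ⟨m, hm, hlow, hup⟩ := exists_tendsto_integral_lindley hX hind hlaw hC hS hδ hmean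
  let B : ℕ → Ω → ℝ := fun k ω => loynes (fun i => X i ω) k
  have hB0 : ∀ k ω, 0 ≤ B k ω := fun k ω => lindley_nonneg _ le_rfl k
  have hBm : ∀ ω, Monotone fun k => B k ω := fun ω => loynes_monotone _
  have hBI : ∀ k, Integrable (B k) P := fun k =>
    (identDistrib_loynes hX hind hlaw k).integrable_iff.2
      (by simpa using integrable_lindley_pow hX hC k 1)
  have hBm' : Tendsto (fun k => ∫ ω, B k ω ∂P) atTop (𝓝 m) :=
    hm.congr fun k => (identDistrib_loynes hX hind hlaw k).integral_eq.symm
  have hmono : Monotone fun k => ∫ ω, B k ω ∂P :=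
    fun k l h => integral_mono (hBI k) (hBI l) fun ω => hBm ω h
  -- The monotone limit might be infinite a priori; the bounded means exclude this almost surely.
  let F : Ω → ENNReal := fun ω => ⨆ k, ENNReal.ofReal (B k ω)
  have hFmeas : Measurable F := .iSup fun k => (measurable_loynes_comp hX k).ennreal_ofReal
  have hF : ∫⁻ ω, F ω ∂P ≠ ⊤ := by
    rw [lintegral_iSup (fun k => (measurable_loynes_comp hX k).ennreal_ofReal)
      fun k l h ω => ENNReal.ofReal_le_ofReal (hBm ω h)]
    refine ne_top_of_le_ne_top (ENNReal.ofReal_ne_top (r := m)) (iSup_le fun k => ?_)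
    rw [← ofReal_integral_eq_lintegral_ofReal (hBI k) (.of_forall (hB0 k))]
    exact ENNReal.ofReal_le_ofReal (hmono.ge_of_tendsto hBm' k)
  have hlim : ∀ᵐ ω ∂P, Tendsto (fun k => B k ω) atTop (𝓝 (F ω).toReal) := by
    filter_upwards [ae_lt_top hFmeas hF] with ω hω
    have h : Tendsto (fun k => ENNReal.ofReal (B k ω)) atTop (𝓝 (F ω)) :=
      tendsto_atTop_iSup fun k l h => ENNReal.ofReal_le_ofReal (hBm ω h)
    refine ((ENNReal.tendsto_toReal hω.ne).comp h).congr fun k => ?_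
    exact ENNReal.toReal_ofReal (hB0 k ω)
  have hFI := integrable_toReal_of_lintegral_ne_top hFmeas.aemeasurable hF
  have hmF : m = ∫ ω, (F ω).toReal ∂P := tendsto_nhds_unique hBm'
    (integral_tendsto_of_tendsto_of_monotone hBI hFI (.of_forall hBm) hlim)
  rw [hmF] at hlow hup
  exact ⟨_, hFI, hlim, hlow, hup⟩

/-- From any initial state, the Lindley recursion with negative drift eventually coincides with the
one started at `0`. -/
lemma eventually_lindley_eq {δ : ℝ} (hX : ∀ k, Measurable (X k)) (hind : iIndepFun X P)
    (hlaw : ∀ k, P.map (X k) = P.map (X 0)) (hint : Integrable (X 0) P) (hδ : 0 < δ)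
    (hmean : ∫ ω, X 0 ω ∂P = -δ) :
    ∀ᵐ ω ∂P, ∀ q, 0 ≤ q →
      ∀ᶠ k in atTop, lindley (fun i => X i ω) q k = lindley (fun i => X i ω) 0 k := by
  have h := strong_law_ae_real X hint (fun i j hij => hind.indepFun hij)
    fun k => ⟨(hX k).aemeasurable, (hX 0).aemeasurable, hlaw k⟩
  filter_upwards [h] with ω hω q hq
  rw [hmean] at hω
  -- By the strong law the averages tend to `-δ`, so the partial sums tend to `-∞` and fall below
  -- `-q`.
  have hT := tendsto_natCast_atTop_atTop (R := ℝ) |>.atTop_mul_neg (neg_neg_of_pos hδ) hω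
  filter_upwards [hT.eventually_le_atBot (-q), eventually_gt_atTop 0] with k hk hk0
  rw [mul_div_cancel₀ _ (by positivity)] at hk
  rw [lindley_eq_sup _ hq]
  exact sup_eq_left.2 ((by linarith : _ ≤ (0 : ℝ)).trans (lindley_nonneg _ le_rfl k))

end Moments

/-! ### Steady state of a dedicated system -/

section System

variable {n : ℕ} {Ω : Type*} [MeasurableSpace Ω] {P : Measure Ω}
  {α σ : Measure (Fin n → ℝ)} {q a s : ℕ → Ω → Fin n → ℝ}

lemma ae_bounded_of_law {ν : Measure (Fin n → ℝ)} {K : ℝ} {Y : ℕ → Ω → Fin n → ℝ}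
    (hν : BoundedLaw ν K) (hY : ∀ k, Measurable (Y k)) (hlaw : ∀ k, P.map (Y k) = ν) :
    ∀ᵐ ω ∂P, ∀ k i, 0 ≤ Y k ω i ∧ Y k ω i ≤ K :=
  ae_all_iff.2 fun k => ae_of_ae_map (hY k).aemeasurable (by rw [hlaw k]; exact hν)

lemma BoundedLaw.memLp {ν : Measure (Fin n → ℝ)} [IsFiniteMeasure ν] {K : ℝ}
    (hν : BoundedLaw ν K) (i : Fin n) : MemLp (fun x : Fin n → ℝ => x i) 2 ν := by
  refine MemLp.of_bound (measurable_pi_apply i).aestronglyMeasurable K ?_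
  filter_upwards [hν] with x hx
  rw [Real.norm_eq_abs, abs_of_nonneg (hx i).1]
  exact (hx i).2

namespace IsDedicatedSystem

lemma queue_eq_lindley (h : IsDedicatedSystem P α σ q a s) (k : ℕ) (ω : Ω) :
    q k ω = lindley (fun j => a j ω - s j ω) (q 0 ω) k := by
  induction k with
  | zero => rfl
  | succ k ih =>
    ext i
    rw [h.dynamics, lindley_succ, ← ih, unusedService]
    simp only [Pi.sup_apply, Pi.add_apply, Pi.sub_apply, Pi.zero_apply]
    rcases le_total (s k ω i) (q k ω i + a k ω i) with hs | hs
    · rw [min_eq_left hs, sup_eq_left.2 (by linarith)]; ring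
    · rw [min_eq_right hs, sup_eq_right.2 (by linarith)]; ring

lemma measurable_increment (h : IsDedicatedSystem P α σ q a s) (k : ℕ) :
    Measurable fun ω => a k ω - s k ω :=
  (h.measurable_arrival k).sub (h.measurable_service k)

lemma measurable_queue (h : IsDedicatedSystem P α σ q a s) (k : ℕ) : Measurable (q k) := by
  induction k with
  | zero => exact h.measurable_init
  | succ k ih =>
    have : q (k + 1) = fun ω => (q k ω + (a k ω - s k ω)) ⊔ 0 := by
      funext ω
      rw [h.queue_eq_lindley, lindley_succ, ← h.queue_eq_lindley]
    rw [this]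
    have hm := ih.add (h.measurable_increment k)
    exact measurable_pi_iff.2 fun i => ((measurable_pi_iff.1 hm) i).sup_const 0

lemma iIndepFun_increment (h : IsDedicatedSystem P α σ q a s) :
    iIndepFun (fun k ω => a k ω - s k ω) P :=
  (iIndepFun_prodMk_of_sum h.measurable_arrival h.measurable_service
    (h.indep.precomp (g := (Sum.inr : ℕ ⊕ ℕ → Unit ⊕ (ℕ ⊕ ℕ))) Sum.inr_injective)).comp
    (fun _ p => p.1 - p.2) fun _ => by fun_prop

lemma indepFun_arrival_service (h : IsDedicatedSystem P α σ q a s) (k : ℕ) :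
    IndepFun (a k) (s k) P :=
  h.indep.indepFun (i := .inr (.inl k)) (j := .inr (.inr k)) (by simp)

lemma map_increment [IsProbabilityMeasure P] (h : IsDedicatedSystem P α σ q a s) (k : ℕ) :
    P.map (fun ω => a k ω - s k ω) = (α.prod σ).map fun p => p.1 - p.2 := by
  have hp := (indepFun_iff_map_prod_eq_prod_map_map (h.measurable_arrival k).aemeasurable
    (h.measurable_service k).aemeasurable).1 (h.indepFun_arrival_service k)
  rw [h.law_arrival, h.law_service] at hp
  rw [← hp, Measure.map_map (by fun_prop)
    ((h.measurable_arrival k).prodMk (h.measurable_service k))]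
  rfl

lemma integral_increment [IsProbabilityMeasure P] (h : IsDedicatedSystem P α σ q a s) {A S : ℝ}
    (hα : BoundedLaw α A) (hσ : BoundedLaw σ S) (i : Fin n) :
    ∫ ω, a 0 ω i - s 0 ω i ∂P = meanVec α i - meanVec σ i := by
  have hma := (h.measurable_arrival 0).aemeasurable (μ := P)
  have hms := (h.measurable_service 0).aemeasurable (μ := P)
  have pα : IsProbabilityMeasure α := h.law_arrival 0 ▸ Measure.isProbabilityMeasure_map hma
  have pσ : IsProbabilityMeasure σ := h.law_service 0 ▸ Measure.isProbabilityMeasure_map hms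
  have ia : Integrable (fun ω => a 0 ω i) P := by
    have := (hα.memLp i).integrable one_le_two
    rw [← h.law_arrival 0] at this
    exact this.comp_aemeasurable hma
  have is : Integrable (fun ω => s 0 ω i) P := by
    have := (hσ.memLp i).integrable one_le_two
    rw [← h.law_service 0] at this
    exact this.comp_aemeasurable hms
  rw [integral_sub ia is, meanVec, meanVec, ← h.law_arrival 0, ← h.law_service 0,
    integral_map hma (measurable_pi_apply i).aestronglyMeasurable,
    integral_map hms (measurable_pi_apply i).aestronglyMeasurable]

lemma integral_increment_sq [IsProbabilityMeasure P] (h : IsDedicatedSystem P α σ q a s) {A S : ℝ}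
    (hα : BoundedLaw α A) (hσ : BoundedLaw σ S) (i : Fin n) :
    ∫ ω, (a 0 ω i - s 0 ω i) ^ 2 ∂P =
      covMat α i i + covMat σ i i + (meanVec α i - meanVec σ i) ^ 2 := by
  have hma := (h.measurable_arrival 0).aemeasurable (μ := P)
  have hms := (h.measurable_service 0).aemeasurable (μ := P)
  have pα : IsProbabilityMeasure α := h.law_arrival 0 ▸ Measure.isProbabilityMeasure_map hma
  have pσ : IsProbabilityMeasure σ := h.law_service 0 ▸ Measure.isProbabilityMeasure_map hms
  have la : MemLp (fun ω => a 0 ω i) 2 P := by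
    have := hα.memLp i
    rw [← h.law_arrival 0] at this
    exact this.comp_of_map hma
  have ls : MemLp (fun ω => s 0 ω i) 2 P := by
    have := hσ.memLp i
    rw [← h.law_service 0] at this
    exact this.comp_of_map hms
  have hind : IndepFun (fun ω => a 0 ω i) (fun ω => s 0 ω i) P :=
    (h.indepFun_arrival_service 0).comp (measurable_pi_apply i) (measurable_pi_apply i)
  have hv := variance_sub la ls
  -- Arrivals and services are independent, so no cross term appears and the second moment is the
  -- two variances plus the squared mean.
  rw [hind.covariance_eq_zero la ls, variance_eq_sub (la.sub ls)] at hv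
  have hm := h.integral_increment hα hσ i
  have ca : covMat α i i = Var[fun ω => a 0 ω i; P] := by
    rw [covMat, covariance_self (measurable_pi_apply i).aemeasurable, ← h.law_arrival 0,
      variance_map (measurable_pi_apply i).aemeasurable hma]
    rfl
  have cs : covMat σ i i = Var[fun ω => s 0 ω i; P] := by
    rw [covMat, covariance_self (measurable_pi_apply i).aemeasurable, ← h.law_service 0,
      variance_map (measurable_pi_apply i).aemeasurable hms]
    rfl
  rw [ca, cs, ← hm]
  simp only [Pi.pow_apply, Pi.sub_apply] at hv
  linarith

/-- A dedicated system with arrival rates below the service rates has a steady state, whose means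
are determined by the variances of arrivals and services up to an error of the order of the
differences of the rates. -/
theorem exists_steadyState [IsProbabilityMeasure P] (h : IsDedicatedSystem P α σ q a s) {A S : ℝ}
    (hα : BoundedLaw α A) (hσ : BoundedLaw σ S) {δ : Fin n → ℝ}
    (hδ : ∀ i, 0 < δ i)
    (hmean : ∀ i, meanVec α i - meanVec σ i = -δ i) :
    ∃ π : ProbabilityMeasure (Fin n → ℝ),
      TendstoInDistribution q atTop id (fun _ => P) (π : Measure (Fin n → ℝ)) ∧
      (∀ i, Integrable (fun x : Fin n → ℝ => x i) (π : Measure (Fin n → ℝ))) ∧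
      ∀ i, covMat α i i + covMat σ i i + δ i ^ 2 - S * δ i ≤
          2 * δ i * ∫ x, x i ∂(π : Measure (Fin n → ℝ)) ∧
        2 * δ i * ∫ x, x i ∂(π : Measure (Fin n → ℝ)) ≤
          covMat α i i + covMat σ i i + δ i ^ 2 := by
  have hX := h.measurable_increment
  have hind := h.iIndepFun_increment
  have hlaw : ∀ k, P.map (fun ω => a k ω - s k ω) = P.map (fun ω => a 0 ω - s 0 ω) :=
    fun k => (h.map_increment k).trans (h.map_increment 0).symm
  have ba := ae_bounded_of_law hα h.measurable_arrival h.law_arrival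
  have bs := ae_bounded_of_law hσ h.measurable_service h.law_service
  have hXi : ∀ i k, Measurable fun ω => a k ω i - s k ω i :=
    fun i k => (measurable_pi_iff.1 (hX k)) i
  have hindi : ∀ i, iIndepFun (fun k ω => a k ω i - s k ω i) P :=
    fun i => hind.comp (fun _ x => x i) fun _ => measurable_pi_apply i
  have hlawi : ∀ i k, P.map (fun ω => a k ω i - s k ω i) = P.map (fun ω => a 0 ω i - s 0 ω i) := by
    intro i k
    have := congr_arg (Measure.map fun x : Fin n → ℝ => x i) (hlaw k)
    rwa [Measure.map_map (measurable_pi_apply i) (hX k),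
      Measure.map_map (measurable_pi_apply i) (hX 0)] at this
  have hC : ∀ i, ∀ᵐ ω ∂P, ∀ k, |a k ω i - s k ω i| ≤ max A S := by
    intro i
    filter_upwards [ba, bs] with ω hωa hωs k
    have h1 := hωa k i
    have h2 := hωs k i
    rw [abs_le]
    constructor <;> linarith [le_max_left A S, le_max_right A S]
  have hS : ∀ i, ∀ᵐ ω ∂P, ∀ k, -S ≤ a k ω i - s k ω i := by
    intro i
    filter_upwards [ba, bs] with ω hωa hωs k
    linarith [(hωa k i).1, (hωs k i).2]
  have hm : ∀ i, ∫ ω, a 0 ω i - s 0 ω i ∂P = -δ i :=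
    fun i => (h.integral_increment hα hσ i).trans (hmean i)
  choose M hMI hMlim hMlow hMup using fun i =>
    integral_loynes_limit (hXi i) (hindi i) (hlawi i) (hC i) (hS i) (hδ i) (hm i)
  have hZ : AEMeasurable (fun ω i => M i ω) P :=
    aemeasurable_pi_iff.2 fun i => (hMI i).aemeasurable
  have hL : ∀ k, Measurable fun ω => loynes (fun j => a j ω - s j ω) k := fun k =>
    (measurable_lindley k).comp (measurable_pi_iff.2 fun _ => hX _)
  have hL0 : ∀ k, Measurable fun ω => lindley (fun j => a j ω - s j ω) 0 k := fun k =>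
    (measurable_lindley k).comp (measurable_pi_iff.2 hX)
  -- Almost sure convergence of every coordinate on one probability space gives convergence of the
  -- joint law, whatever the correlations.
  have hconv : TendstoInDistribution (fun k ω => loynes (fun j => a j ω - s j ω) k) atTop
      (fun ω i => M i ω) (fun _ => P) P := by
    refine tendstoInDistribution_of_ae_tendsto (fun k => (hL k).aemeasurable) hZ ?_
    filter_upwards [ae_all_iff.2 hMlim] with ω hω
    refine tendsto_pi_nhds.2 fun i => (hω i).congr fun k => ?_
    exact (loynes_apply (fun j => a j ω - s j ω) k i).symm
  have pZ : IsProbabilityMeasure (P.map fun ω i => M i ω) := Measure.isProbabilityMeasure_map hZ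
  have hconv0 : TendstoInDistribution (fun k ω => lindley (fun j => a j ω - s j ω) 0 k) atTop
      id (fun _ => P) (P.map fun ω i => M i ω) := by
    refine ⟨fun k => (hL0 k).aemeasurable, aemeasurable_id, ?_⟩
    simpa only [map_loynes_eq hX hind hlaw (measurable_lindley _), Measure.map_id]
      using hconv.tendsto
  have hcoupling : ∀ᵐ ω ∂P, Tendsto
      (fun k => q k ω - lindley (fun j => a j ω - s j ω) 0 k) atTop (𝓝 0) := by
    have he : ∀ᵐ ω ∂P, ∀ i, ∀ x, 0 ≤ x → ∀ᶠ k in atTop,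
        lindley (fun j => a j ω i - s j ω i) x k = lindley (fun j => a j ω i - s j ω i) 0 k := by
      refine ae_all_iff.2 fun i => eventually_lindley_eq (hXi i) (hindi i) (hlawi i) ?_ (hδ i) (hm i)
      refine Integrable.of_bound (hXi i 0).aestronglyMeasurable (max A S) ?_
      filter_upwards [hC i] with ω hω using hω 0
    -- With finitely many coordinates, the two recursions eventually agree in all of them.
    filter_upwards [he, h.init_nonneg] with ω hω hω0
    refine tendsto_const_nhds.congr' ?_
    filter_upwards [eventually_all.2 fun i => hω i _ (hω0 i)] with k hk
    rw [h.queue_eq_lindley]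
    ext i
    rw [Pi.sub_apply, lindley_apply, lindley_apply]
    exact (sub_eq_zero.2 (hk i)).symm
  refine ⟨⟨P.map fun ω i => M i ω, pZ⟩, ?_, fun i => ?_, fun i => ?_⟩
  · refine tendstoInDistribution_of_tendstoInMeasure_sub (μ' := P.map fun ω i => M i ω) q id
      hconv0 ?_ fun k => (h.measurable_queue k).aemeasurable
    exact tendstoInMeasure_of_tendsto_ae
      (fun k => ((h.measurable_queue k).sub (hL0 k)).aestronglyMeasurable) hcoupling
  · exact (integrable_map_measure (measurable_pi_apply i).aestronglyMeasurable hZ).2 (hMI i)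
  · have hi : ∫ x, x i ∂(P.map fun ω i => M i ω) = ∫ ω, M i ω ∂P :=
      integral_map hZ (measurable_pi_apply i).aestronglyMeasurable
    have hsq := h.integral_increment_sq hα hσ i
    rw [hmean, neg_sq] at hsq
    rw [ProbabilityMeasure.coe_mk, hi, ← hsq]
    exact ⟨hMlow i, hMup i⟩

end IsDedicatedSystem

end System

/-! ### Heavy-traffic limit -/

theorem corollary4 {n : ℕ} (Amax Smax : ℝ)
    -- the law of the potential service vector (the same for all `ε`)
    (σ : Measure (Fin n → ℝ)) [IsProbabilityMeasure σ] (hσ : BoundedLaw σ Smax)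
    (hμ : ∀ i, 0 < meanVec σ i)
    -- the laws of the arrival vectors
    (α : ℝ → Measure (Fin n → ℝ)) (hα : ∀ ε ∈ Ioo (0 : ℝ) 1, BoundedLaw (α ε) Amax)
    (hmean : ∀ ε ∈ Ioo (0 : ℝ) 1, ∀ i, meanVec (α ε) i = (1 - ε) * meanVec σ i)
    -- the limit of the arrival covariance matrices
    (Sa : Matrix (Fin n) (Fin n) ℝ)
    (hcov : ∀ i j, Tendsto (fun ε => covMat (α ε) i j) (𝓝[>] 0) (𝓝 (Sa i j)))
    -- the systems
    {Ω : ℝ → Type*} [∀ ε, MeasurableSpace (Ω ε)] (P : ∀ ε, Measure (Ω ε))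
    [∀ ε, IsProbabilityMeasure (P ε)] (q a s : ∀ ε, ℕ → Ω ε → Fin n → ℝ)
    (hsys : ∀ ε ∈ Ioo (0 : ℝ) 1, IsDedicatedSystem (P ε) (α ε) σ (q ε) (a ε) (s ε)) :
    -- the steady-state laws `π ε` of the queue length vectors, and the limit of the means
    ∃ π : ℝ → ProbabilityMeasure (Fin n → ℝ),
      (∀ ε ∈ Ioo (0 : ℝ) 1,
        TendstoInDistribution (q ε) atTop id (fun _ => P ε) (π ε : Measure (Fin n → ℝ)) ∧
        ∀ i, Integrable (fun x : Fin n → ℝ => x i) (π ε : Measure (Fin n → ℝ))) ∧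
      Tendsto
        (fun ε => ε * ∫ x, ∑ i, meanVec σ i * x i ∂(π ε : Measure (Fin n → ℝ)))
        (𝓝[>] 0) (𝓝 (1 / 2 * ∑ i, (Sa i i + covMat σ i i))) := by
  have key : ∀ ε, ∃ π : ProbabilityMeasure (Fin n → ℝ), ε ∈ Ioo (0 : ℝ) 1 → _ := fun ε => by
    by_cases hε : ε ∈ Ioo (0 : ℝ) 1
    · obtain ⟨π, hπ⟩ := (hsys ε hε).exists_steadyState (hα ε hε) hσ
        (δ := fun i => ε * meanVec σ i) (fun i => mul_pos hε.1 (hμ i))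
        (fun i => by rw [hmean ε hε]; ring)
      exact ⟨π, fun _ => hπ⟩
    · exact ⟨⟨σ, inferInstance⟩, fun h => absurd h hε⟩
  choose π hπ using key
  refine ⟨π, fun ε hε => ⟨(hπ ε hε).1, (hπ ε hε).2.1⟩, ?_⟩
  have hcoord : ∀ i, Tendsto (fun ε => ε * meanVec σ i * ∫ x, x i ∂(π ε : Measure (Fin n → ℝ)))
      (𝓝[>] 0) (𝓝 (1 / 2 * (Sa i i + covMat σ i i))) := by
    intro i
    have h0 : Tendsto (fun ε : ℝ => ε * meanVec σ i) (𝓝[>] 0) (𝓝 0) := by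
      have : Tendsto (fun ε : ℝ => ε * meanVec σ i) (𝓝 0) (𝓝 (0 * meanVec σ i)) :=
        tendsto_id.mul_const _
      rw [zero_mul] at this
      exact this.mono_left nhdsWithin_le_nhds
    have hup : Tendsto (fun ε => 1 / 2 *
        (covMat (α ε) i i + covMat σ i i + (ε * meanVec σ i) ^ 2)) (𝓝[>] 0)
        (𝓝 (1 / 2 * (Sa i i + covMat σ i i))) := by
      have := (((hcov i i).add_const (covMat σ i i)).add (h0.pow 2)).const_mul (1 / 2)
      rwa [zero_pow two_ne_zero, add_zero] at this
    -- Half of the error `S * δ`, with `δ = ε * meanVec σ i`.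
    have hlow := hup.sub (h0.const_mul (1 / 2 * Smax))
    rw [mul_zero, sub_zero] at hlow
    have hev : ∀ᶠ ε : ℝ in 𝓝[>] 0, ε ∈ Ioo (0 : ℝ) 1 := Ioo_mem_nhdsGT one_pos
    refine tendsto_of_tendsto_of_tendsto_of_le_of_le' hlow hup ?_ ?_
    · filter_upwards [hev] with ε hε
      linarith [((hπ ε hε).2.2 i).1]
    · filter_upwards [hev] with ε hε
      linarith [((hπ ε hε).2.2 i).2]
  rw [Finset.mul_sum]
  refine (tendsto_finsetSum _ fun i _ => hcoord i).congr' ?_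
  filter_upwards [Ioo_mem_nhdsGT (zero_lt_one (α := ℝ))] with ε hε
  rw [integral_finsetSum _ fun i _ => ((hπ ε hε).2.1 i).const_mul _, Finset.mul_sum]
  exact Finset.sum_congr rfl fun i _ => by rw [integral_const_mul, mul_assoc]
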